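/- **Setting.** Let $X\subseteq\mathbb R^n$, let $\mathcal Q$ be a finite set with $N_q$ elements, $\mathcal S=X\times\mathcal Q$, and let $\mathcal U$ be a compact metrizable space with its Borel $\sigma$-algebra. A discrete time stochastic hybrid system is given by Markov kernels $T_q(q'\mid s,u)$ and $T_x(dx'\mid s,u,q')$; put $\tau(ds'\mid s,u)=T_x(dx'\mid s,u,q')\,T_q(q'\mid s,u)$ for $s'=(x',q')$. The state $s_k=(x_k,q_k)$ is observed through $y_k=(y^x_k,y^q_k)\in\mathbb R^n\times\mathcal Q$, $k\ge1$, where $y^x_k=h(x_k,u_{k-1})+v_k$ and $\mathbb P[y^q_k=j\mid q_k=q,u_{k-1}=u]=Q_{q,j}(u)$, conditionally independent given $(s_k,u_{k-1})$. Here $h$ is bounded and continuous, the $v_k$ are i.i.d. with a strictly positive density $\phi$, and $Q_{q,j}(u)>0$ is measurable in $u$ with $\sum_jQ_{q,j}(u)=1$. Let $\rho$ be a probability measure on $\mathcal S$ (the law of $s_0$), $K\subseteq\mathcal S$ a Borel set and $N\ge0$ a horizon. Let $i_k=(y_1,\dots,y_k,u_0,\dots,u_{k-1})$. The set $\Pi$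 of admissible policies consists of the sequences $\pi=(\mu_k)_k$ of Borel maps from information vectors $i_k$ to $\mathcal U$; $u_k=\mu_k(i_k)$. Let $\mathbb P^\pi$ be the resulting law and $r_K(\pi)=\mathbb P^\pi[s_i\in K,\ i=0,\dots,N]$. Let $$\Lambda_k=\prod_{l=1}^k\frac{\phi(y^x_l-h(x_l,u_{l-1}))\,Q_{q_l,y^q_l}(u_{l-1})}{\phi(y^x_l)\,\frac1{N_q}},$$ and let $\mathbb P^\dagger$ be the measure with $d\mathbb P^\pi/d\mathbb P^\dagger=\Lambda_k$ on trajectories up to time $k$. The sufficient statistic is the measure $\sigma_k=\eta_k(\rho,i_k)$ on $\mathcal S$, $$\eta_k(\rho,i_k)(B)=\int \mathbf 1_B(s_k)\prod_{i=0}^{k-1}\mathbf 1_K(s_i)\,\Lambda_k\ \rho(ds_0)\prod_{l=1}^{k}\tau(ds_l\mid s_{l-1},u_{l-1}),$$ with the observations and controls of $i_k$ held fixed. For a finite measure $\sigma$ on $\mathcal S$ put $$T_{u,y}[\sigma](ds)=N_q\,Q_{q,y^q}(u)\,\frac{\phi(y^x-h(x,u))}{\phi(y^x)}\int_K\tau(ds\mid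 s^-,u)\,\sigma(ds^-),\qquad s=(x,q),$$ and, for a function $V\ge 0$ of measures, $E_u[V](\sigma)=\sum_{y^q\in\mathcal Q}\int_{\mathbb R^n}V(T_{u,y}[\sigma])\,\frac1{N_q}\phi(y^x)\,dy^x$. Define $V_N^*(\sigma)=\sigma(K)$ and $V_k^*(\sigma)=\sup_{u\in\mathcal U}E_u[V_{k+1}^*](\sigma)$ for $k<N$. Let $\Sigma_0,\dots,\Sigma_N$ be Borel sets of finite measures on $\mathcal S$ (for the $\sigma$-algebra generated by the maps $\sigma\mapsto\sigma(B)$) with $\rho\in\Sigma_0$ and, for all $k<N$, $\sigma\in\Sigma_k$ and $u\in\mathcal U$, $T_{u,y}[\sigma]\in\Sigma_{k+1}$ for every $y^q$ and Lebesgue-almost every $y^x$. (For example: all finite measures; or, when $\rho$ and $\tau$ have densities, the measures with a nonnegative density in $L^1(\mathcal S)$.) An information-state policy $\bar\pi=(\bar\mu_k)_k$ consists of Borel maps from measures on $\mathcal S$ to $\mathcal U$, and $\bar r_K(\bar\pi)=\mathbb E^\dagger[\sigma_N(K)]$ when the controls are $u_k=\bar\mu_k(\sigma_k)$. **Theorem.**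 Let $\bar\pi^*=(\bar\mu_k^*)_k$ be an information-state policy that is optimal in the sense of dynamic programming: for all $k<N$ and $\sigma\in\Sigma_k$, $\bar\mu_k^*(\sigma)$ maximizes $u\mapsto E_u[V_{k+1}^*](\sigma)$ over $\mathcal U$. Then: 1. for every $\pi\in\Pi$, $k\le N$ and Borel $B\subseteq\mathcal S$, $\eta_k(\rho,i_k)(B)=\mathbb E^\dagger\big[\mathbf 1_B(s_k)\prod_{i=0}^{k-1}\mathbf 1_K(s_i)\Lambda_k\,\big|\,i_k\big]$ almost surely under $\mathbb P^\dagger$; 2. the policy $\pi^*$ given by $u_k^*=\mu_k^*(i_k)=\bar\mu_k^*(\eta_k(\rho,i_k))$ is admissible, and it is optimal for the partially observable reachability problem: $$\bar r_K(\bar\pi^*)=\sup_{\pi\in\Pi}r_K(\pi)=r_K(\pi^*).$$ -/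

import Mathlib

open MeasureTheory ProbabilityTheory
open scoped ENNReal NNReal

noncomputable section

/-- The continuous ambient space `ℝⁿ`. -/
abbrev Rn (n : ℕ) : Type := EuclideanSpace ℝ (Fin n)

/-- The hybrid state space `S = X × Q`, with `X ⊆ ℝⁿ`. -/
abbrev HybridState {n : ℕ} (X : Set (Rn n)) (Q : Type*) := X × Q

/-- The observation space `Y = ℝⁿ × Q`. -/
abbrev Obs (n : ℕ) (Q : Type*) := Rn n × Q

/-- The information vector `i_k = (y_1, …, y_k, u_0, …, u_{k-1})`;
`i.1 l` is `y_{l+1}` and `i.2 l` is `u_l`. -/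
abbrev Info (n : ℕ) (Q U : Type*) (k : ℕ) := (Fin k → Obs n Q) × (Fin k → U)

/-- Trajectories up to time `k`: the states `s_0, …, s_k` and the information vector `i_k`. -/
abbrev Traj {n : ℕ} (X : Set (Rn n)) (Q U : Type*) (k : ℕ) :=
  (Fin (k + 1) → HybridState X Q) × Info n Q U k

/-- A discrete time stochastic hybrid system. The discrete state is updated first, by `Tq` given
`(s_k, u_k)`; the continuous state is then updated by `Tx` given `(s_k, u_k)` and `q_{k+1}`. -/
structure DTSHS {n : ℕ} (X : Set (Rn n)) (Q U : Type*)
    [MeasurableSpace Q] [MeasurableSpace U] where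
  Tq : Kernel (HybridState X Q × U) Q
  Tx : Kernel ((HybridState X Q × U) × Q) X
  Tq_markov : IsMarkovKernel Tq
  Tx_markov : IsMarkovKernel Tx

/-- A partially observable DTSHS: the observations are `y_k^x = h(x_k, u_{k-1}) + v_k`, with
i.i.d. noise `v_k` of positive density `φ`, and `y_k^q`, which equals `j` with probability
`Qobs q_k j u_{k-1}`. The discrete observation probabilities are nowhere zero. -/
structure PODTSHS {n : ℕ} (X : Set (Rn n)) (Q U : Type*) [Fintype Q]
    [MeasurableSpace Q] [TopologicalSpace U] [MeasurableSpace U] extends DTSHS X Q U where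
  h : X → U → Rn n
  h_continuous : Continuous (fun p : X × U => h p.1 p.2)
  h_bounded : ∃ C : ℝ, ∀ x u, ‖h x u‖ ≤ C
  φ : Rn n → ℝ≥0
  φ_measurable : Measurable φ
  φ_pos : ∀ v, 0 < φ v
  φ_lintegral : ∫⁻ v, (φ v : ℝ≥0∞) = 1
  Qobs : Q → Q → U → ℝ≥0
  Qobs_measurable : ∀ q j, Measurable (Qobs q j)
  Qobs_pos : ∀ q j u, 0 < Qobs q j u
  Qobs_sum : ∀ q u, ∑ j, Qobs q j u = 1

namespace PODTSHS

variable {n : ℕ} {X : Set (Rn n)} {Q U : Type*} [Fintype Q] [MeasurableSpace Q]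
  [TopologicalSpace U] [MeasurableSpace U]

/-- The hybrid transition kernel `τ(ds' | s, u) = Tx(dx' | s, u, q') Tq(q' | s, u)`. -/
def τ (H : PODTSHS X Q U) : Kernel (HybridState X Q × U) (HybridState X Q) :=
  (H.Tq ⊗ₖ H.Tx).map Prod.swap

/-- The law of the observation made in the new state `s`, reached under the control `u`. -/
def obsLaw (H : PODTSHS X Q U) (s : HybridState X Q) (u : U) : Measure (Obs n Q) :=
  ((volume.withDensity fun v => (H.φ v : ℝ≥0∞)).map fun v => H.h s.1 u + v).prod
    (∑ j, (H.Qobs s.2 j u : ℝ≥0∞) • Measure.dirac j)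

/-- A (non-randomized) policy `π = (μ_0, μ_1, …)`, each `μ_k` mapping the information vector `i_k`
to a control. For the horizon `N` only `μ_0, …, μ_{N-1}` matter. -/
abbrev Policy (n : ℕ) (Q U : Type*) := (k : ℕ) → Info n Q U k → U

/-- A policy on information states: `μ̄_k` maps a measure on `S` (the information state at time
`k`) to a control. -/
abbrev InfoPolicy {n : ℕ} (X : Set (Rn n)) (Q U : Type*) [MeasurableSpace Q] :=
  ℕ → Measure (HybridState X Q) → U

/-- The set `Π` of admissible policies. -/
def admissible (n : ℕ) (Q U : Type*) [MeasurableSpace Q] [MeasurableSpace U] :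
    Set (Policy n Q U) :=
  {π | ∀ k, Measurable (π k)}

/-- The law `ℙ^π` of the trajectory up to time `k` under the policy `π` with `s_0 ∼ ρ`: the
control is `u_k = μ_k(i_k)`, the new state has law `τ(· | s_k, u_k)`, and the new observation has
the observation law of the new state and `u_k`. -/
def law (H : PODTSHS X Q U) (ρ : Measure (HybridState X Q)) (π : Policy n Q U) :
    (k : ℕ) → Measure (Traj X Q U k)
  | 0 => ρ.map fun s => (fun _ => s, (Fin.elim0, Fin.elim0))
  | k + 1 => (H.law ρ π k).bind fun ω =>
      (H.τ (ω.1 (Fin.last k), π k ω.2)).bind fun s' =>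
        (H.obsLaw s' (π k ω.2)).map fun y =>
          (Fin.snoc (α := fun _ => HybridState X Q) ω.1 s',
            (Fin.snoc (α := fun _ => Obs n Q) ω.2.1 y,
              Fin.snoc (α := fun _ => U) ω.2.2 (π k ω.2)))

/-- The safety probability `r_K(π) = ℙ^π[s_i ∈ K for all i = 0, …, N]`. -/
def safetyProb (H : PODTSHS X Q U) (ρ : Measure (HybridState X Q)) (K : Set (HybridState X Q))
    (N : ℕ) (π : Policy n Q U) : ℝ≥0∞ :=
  H.law ρ π N {ω | ∀ i, ω.1 i ∈ K}

/-- The likelihood ratio `φ(y^x - h(x,u)) Q_{q,y^q}(u) / (φ(y^x) (1/N_q))`. -/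
def likelihood (H : PODTSHS X Q U) (s : HybridState X Q) (u : U) (y : Obs n Q) : ℝ≥0∞ :=
  ((H.φ (y.1 - H.h s.1 u) : ℝ≥0∞) * H.Qobs s.2 y.2 u) /
    ((H.φ y.1 : ℝ≥0∞) * (1 / (Fintype.card Q : ℝ≥0∞)))

/-- `Λ_k`, the product of the likelihood ratios at the times `1, …, k`. -/
def Lam (H : PODTSHS X Q U) (k : ℕ) (s : Fin (k + 1) → HybridState X Q) (i : Info n Q U k) :
    ℝ≥0∞ :=
  ∏ l : Fin k, H.likelihood (s l.succ) (i.2 l) (i.1 l)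

/-- The changed measure `ℙ†` on trajectories up to time `k`, given by `dℙ^π / dℙ† = Λ_k`. -/
def refLaw (H : PODTSHS X Q U) (ρ : Measure (HybridState X Q)) (π : Policy n Q U) (k : ℕ) :
    Measure (Traj X Q U k) :=
  (H.law ρ π k).withDensity fun ω => (H.Lam k ω.1 ω.2)⁻¹

/-- The law of the states `s_0, …, s_k` under the fixed controls `u_0, …, u_{k-1}`. -/
def pathLaw (H : PODTSHS X Q U) (ρ : Measure (HybridState X Q)) :
    (k : ℕ) → (Fin k → U) → Measure (Fin (k + 1) → HybridState X Q)
  | 0, _ => ρ.map fun s _ => s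
  | k + 1, u => (H.pathLaw ρ k (Fin.init (α := fun _ => U) u)).bind fun s =>
      (H.τ (s (Fin.last k), u (Fin.last k))).map fun s' =>
        Fin.snoc (α := fun _ => HybridState X Q) s s'

/-- `∏_{i=0}^{k-1} 1_K(s_i)`: the states before time `k` are safe. -/
def safeBefore (K : Set (HybridState X Q)) (k : ℕ) (s : Fin (k + 1) → HybridState X Q) : ℝ≥0∞ :=
  ∏ l : Fin k, K.indicator (fun _ => (1 : ℝ≥0∞)) (s l.castSucc)

/-- The sufficient statistic `σ_k = η_k(ρ, i_k)`, the unnormalized conditional law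
`B ↦ 𝔼†[1_B(s_k) ∏_{i<k} 1_K(s_i) Λ_k | i_k]`, in the version that integrates over the states
`s_0, …, s_k` with the observations and controls in `i_k` held fixed. -/
def eta (H : PODTSHS X Q U) (ρ : Measure (HybridState X Q)) (K : Set (HybridState X Q)) (k : ℕ)
    (i : Info n Q U k) : Measure (HybridState X Q) :=
  ((H.pathLaw ρ k i.2).withDensity fun s => safeBefore K k s * H.Lam k s i).map
    fun s => s (Fin.last k)

/-- `η_k` is a version of the conditional expectation given `i_k` under `ℙ†`, for the policy `π`:
`η_k(ρ, i_k)(B) = 𝔼†[1_B(s_k) ∏_{i<k} 1_K(s_i) Λ_k | i_k]` almost surely, for each Borel `B`. -/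
def EtaIsCondExp (H : PODTSHS X Q U) (ρ : Measure (HybridState X Q))
    (K : Set (HybridState X Q)) (π : Policy n Q U) (k : ℕ) : Prop :=
  ∀ B : Set (HybridState X Q), MeasurableSet B →
    (H.refLaw ρ π k)[fun ω => (B.indicator (fun _ => (1 : ℝ≥0∞)) (ω.1 (Fin.last k)) *
        safeBefore K k ω.1 * H.Lam k ω.1 ω.2).toReal |
      MeasurableSpace.comap (fun ω : Traj X Q U k => ω.2) inferInstance]
    =ᵐ[H.refLaw ρ π k] fun ω => (H.eta ρ K k ω.2 B).toReal

/-- The update operator `T_{u,y}`, on measures: if `σ` and `τ(· | s⁻, u)` have densities, then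
`T_{u,y}[σ]` has the density
`(x,q) ↦ ∑_{q⁻} N_q Q_{q,y^q}(u) ∫ 1_K(x⁻,q⁻) φ(y^x - h(x,u))/φ(y^x) τ(x,q|x⁻,q⁻,u) σ(x⁻,q⁻) dx⁻`.
-/
def T (H : PODTSHS X Q U) (K : Set (HybridState X Q)) (u : U) (y : Obs n Q)
    (σ : Measure (HybridState X Q)) : Measure (HybridState X Q) :=
  ((σ.restrict K).bind fun s => H.τ (s, u)).withDensity fun s' => H.likelihood s' u y

/-- `𝔼†[V(T_{u,y}[σ])] = ∑_{y^q} ∫ V(T_{u,y}[σ]) (1/N_q) φ(y^x) dy^x`. -/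
def expectedNext (H : PODTSHS X Q U) (K : Set (HybridState X Q))
    (V : Measure (HybridState X Q) → ℝ≥0∞) (σ : Measure (HybridState X Q)) (u : U) : ℝ≥0∞ :=
  ∑ yq : Q, ∫⁻ yx : Rn n,
    V (H.T K u (yx, yq) σ) * (1 / (Fintype.card Q : ℝ≥0∞)) * (H.φ yx : ℝ≥0∞)

/-- The dynamic programming values by the number of steps that remain. -/
def valueToGo (H : PODTSHS X Q U) (K : Set (HybridState X Q)) :
    ℕ → Measure (HybridState X Q) → ℝ≥0∞
  | 0, σ => σ K
  | j + 1, σ => ⨆ u : U, H.expectedNext K (H.valueToGo K j) σ u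

/-- `V_k^*` for the horizon `N` and `k ≤ N`: `V_N^*(σ) = ⟨σ, 1_K⟩ = σ(K)` and
`V_k^*(σ) = sup_u 𝔼†[V_{k+1}^*(T_{u,y}[σ])]`. -/
def optValue (H : PODTSHS X Q U) (K : Set (HybridState X Q)) (N k : ℕ) :
    Measure (HybridState X Q) → ℝ≥0∞ :=
  H.valueToGo K (N - k)

/-- Information-state spaces `Σ_0, …, Σ_N`: Borel sets of finite measures on `S` such that `Σ_0`
contains the initial law and `T_{u,y}` maps `Σ_k` to `Σ_{k+1}` for almost every `y`. Examples are
all finite measures or, when `ρ` and `τ` have densities, the measures with a nonnegative density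
in `L¹(S)`. -/
structure IsInfoStateSpace (H : PODTSHS X Q U) (ρ : Measure (HybridState X Q))
    (K : Set (HybridState X Q)) (N : ℕ) (Sig : ℕ → Set (Measure (HybridState X Q))) : Prop where
  measurableSet : ∀ k ≤ N, MeasurableSet (Sig k)
  finite : ∀ k ≤ N, ∀ σ ∈ Sig k, IsFiniteMeasure σ
  initial : ρ ∈ Sig 0
  step : ∀ k < N, ∀ σ ∈ Sig k, ∀ (u : U) (yq : Q),
    ∀ᵐ yx : Rn n, H.T K u (yx, yq) σ ∈ Sig (k + 1)

/-- `μ̄_k^*(σ)` attains the supremum in the dynamic programming equation, for all `k < N` and all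
information states `σ ∈ Σ_k`. -/
def IsDPOptimal (H : PODTSHS X Q U) (K : Set (HybridState X Q)) (N : ℕ)
    (Sig : ℕ → Set (Measure (HybridState X Q))) (μbar : InfoPolicy X Q U) : Prop :=
  ∀ k < N, ∀ σ ∈ Sig k, ∀ u : U,
    H.expectedNext K (H.optValue K N (k + 1)) σ u ≤
      H.expectedNext K (H.optValue K N (k + 1)) σ (μbar k σ)

/-- The policy `μ_k(i_k) = μ̄_k(η_k(ρ, i_k))`. -/
def induced (H : PODTSHS X Q U) (ρ : Measure (HybridState X Q)) (K : Set (HybridState X Q))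
    (μbar : InfoPolicy X Q U) : Policy n Q U :=
  fun k i => μbar k (H.eta ρ K k i)

/-- `r̄_K(π̄) = 𝔼†[⟨σ_N, 1_K⟩]`, where `σ_k = η_k(ρ, i_k)` and the controls are `u_k = μ̄_k(σ_k)`. -/
def infoReward (H : PODTSHS X Q U) (ρ : Measure (HybridState X Q)) (K : Set (HybridState X Q))
    (N : ℕ) (μbar : InfoPolicy X Q U) : ℝ≥0∞ :=
  ∫⁻ ω, H.eta ρ K N ω.2 K ∂(H.refLaw ρ (H.induced ρ K μbar) N)

end PODTSHS

end

/-!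
The trajectory law is disintegrated along the information vector. Since `likelihood` is the density
of the true observation law with respect to the state-independent law `refObs`
(`obsLaw_eq_withDensity`), an induction on time with Tonelli's theorem gives Bayes' formula
`lintegral_law`: under `ℙ^π` one may draw `i_k` from the law `refInfo`, in which the observations
are i.i.d., then draw the states from `pathLaw` with the controls of `i_k` held fixed, and weight by
`Λ_k`. Removing the weight gives `ℙ†` (`lintegral_refLaw`), so integrating out the states is
conditioning on `i_k`, and `eta` is a version of the conditional expectation (`etaIsCondExp`).
The same formula turns both rewards into `∫ η_N(i)(K)` against `refInfo` (`safetyProb_eq`,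
`infoReward_eq`).

The information state satisfies `σ_{k+1} = T_{u_k, y_{k+1}}[σ_k]` pointwise (`eta_extend`), and
under `refInfo` the new observation is independent of the past. So the expectation of `V_{k+1}^*(σ_{k+1})`
is the expectation of `E_{u_k}[V_{k+1}^*](σ_k)` (`lintegral_optValue_succ`). This is at most the
expectation of `V_k^*(σ_k)` for every admissible policy, with equality for the induced one. By
induction `V_0^*(ρ)` bounds every safety probability, and the induced policy attains it.

Two points of measurability need care. The value function is a supremum over uncountably many
controls; on the information-state spaces it is measurable because a measurable policy attains it
(`exists_measurable_eq_optValue`). Parameter integrals `∫ f(s, a) σ(ds)` must be measurable jointly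
in `(σ, a)`, and the identity is not an s-finite kernel on measures; `finiteMeasureKernel`
replaces it on finite measures. As `φ` need not be bounded, `η_k` may be infinite for a null set of
observations; its measurability in `i_k` is therefore proved from its integral formula
(`measurable_eta`), not by iterating `T`.
-/

noncomputable section

/-! ### Measurability of families of measures -/

section General

variable {α β γ δ : Type*} [MeasurableSpace α] [MeasurableSpace β] [MeasurableSpace γ]
  [MeasurableSpace δ]

lemma measurable_of_measurable_lintegral {κ : α → Measure β}
    (h : ∀ g : β → ℝ≥0∞, Measurable g → Measurable fun a => ∫⁻ b, g b ∂κ a) : Measurable κ := by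
  refine Measure.measurable_of_measurable_coe _ fun B hB => ?_
  simpa [lintegral_indicator_one hB] using h (B.indicator 1) (measurable_one.indicator hB)

lemma measurable_lintegral_kernel_comp (κ : Kernel β γ) [IsSFiniteKernel κ] {g : α → β}
    (hg : Measurable g) {f : α → γ → ℝ≥0∞} (hf : Measurable (Function.uncurry f)) :
    Measurable fun a => ∫⁻ c, f a c ∂κ (g a) :=
  Measurable.lintegral_kernel_prod_right (κ := κ.comap g hg) hf

lemma measurable_snoc (k : ℕ) :
    Measurable fun p : (Fin k → α) × α =>
      (Fin.snoc (α := fun _ => α) p.1 p.2 : Fin (k + 1) → α) := by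
  refine measurable_pi_iff.2 fun i => ?_
  refine Fin.lastCases ?_ (fun j => ?_) i
  · simpa using measurable_snd
  · simp only [Fin.snoc_castSucc]
    exact (measurable_pi_apply j).comp measurable_fst

lemma Measurable.snoc {k : ℕ} {f : α → Fin k → β} {g : α → β} (hf : Measurable f)
    (hg : Measurable g) :
    Measurable fun a => (Fin.snoc (α := fun _ => β) (f a) (g a) : Fin (k + 1) → β) :=
  (measurable_snoc k).comp (hf.prodMk hg)

lemma measurable_init (k : ℕ) :
    Measurable fun u : Fin (k + 1) → α => (Fin.init (α := fun _ => α) u : Fin k → α) :=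
  measurable_pi_iff.2 fun i => measurable_pi_apply i.castSucc

lemma measurable_kernel_map (κ : Kernel β γ) [IsSFiniteKernel κ] {g : α → β} (hg : Measurable g)
    {f : α → γ → δ} (hf : Measurable (Function.uncurry f)) :
    Measurable fun a => (κ (g a)).map (f a) := by
  refine measurable_of_measurable_lintegral fun G hG => ?_
  simp_rw [fun a => lintegral_map (μ := κ (g a)) hG (hf.of_uncurry_left (x := a))]
  exact measurable_lintegral_kernel_comp κ hg (hG.comp hf)

lemma measurable_kernel_bind (κ : Kernel β γ) [IsSFiniteKernel κ] {g : α → β} (hg : Measurable g)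
    {m : α → γ → Measure δ} (hm : Measurable (Function.uncurry m)) :
    Measurable fun a => (κ (g a)).bind (m a) := by
  refine measurable_of_measurable_lintegral fun G hG => ?_
  simp_rw [fun a => Measure.lintegral_bind (m := κ (g a))
    (hm.of_uncurry_left (x := a)).aemeasurable hG.aemeasurable]
  exact measurable_lintegral_kernel_comp κ hg ((Measure.measurable_lintegral hG).comp hm)

/-- The map `σ ↦ σ / σ(univ)`, as a kernel on measures; it is finite, although the identity is not
s-finite as a kernel. -/
def normalizeKernel (α : Type*) [MeasurableSpace α] : Kernel (Measure α) α where
  toFun σ := (σ Set.univ)⁻¹ • σ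
  measurable' := by
    refine Measure.measurable_of_measurable_coe _ fun B hB => ?_
    simp only [Measure.smul_apply, smul_eq_mul]
    exact (Measure.measurable_coe MeasurableSet.univ).inv.mul (Measure.measurable_coe hB)

instance : IsFiniteKernel (normalizeKernel α) :=
  ⟨1, ENNReal.one_lt_top, fun σ => by
    simp [normalizeKernel, ENNReal.inv_mul_le_one]⟩

/-- An s-finite kernel on measures that maps every finite measure to itself. Infinite measures are
mapped to `0`. -/
def finiteMeasureKernel (α : Type*) [MeasurableSpace α] : Kernel (Measure α) α :=
  (normalizeKernel α).withDensity fun σ _ => ((σ Set.univ).toNNReal : ℝ≥0∞)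

instance : IsSFiniteKernel (finiteMeasureKernel α) :=
  Kernel.IsSFiniteKernel.withDensity _ fun _ _ => ENNReal.coe_ne_top

lemma finiteMeasureKernel_apply (σ : Measure α) [IsFiniteMeasure σ] :
    finiteMeasureKernel α σ = σ := by
  have h : Measurable (Function.uncurry fun (σ : Measure α) (_ : α) =>
      ((σ Set.univ).toNNReal : ℝ≥0∞)) :=
    ((Measure.measurable_coe MeasurableSet.univ).comp
      measurable_fst).ennreal_toNNReal.coe_nnreal_ennreal
  rw [finiteMeasureKernel, Kernel.withDensity_apply _ h, withDensity_const,
    ENNReal.coe_toNNReal (measure_ne_top σ _)]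
  change σ Set.univ • (σ Set.univ)⁻¹ • σ = σ
  rcases eq_or_ne σ 0 with rfl | h0
  · simp
  · rw [smul_smul, ENNReal.mul_inv_cancel (by simpa using h0) (measure_ne_top σ _), one_smul]

end General

/-! ### Likelihood ratio and change of observation law -/

namespace PODTSHS

variable {n : ℕ} {X : Set (Rn n)} {Q U : Type*} [Fintype Q] [MeasurableSpace Q]
  [TopologicalSpace U] [MeasurableSpace U] (H : PODTSHS X Q U)

instance : IsMarkovKernel H.τ := by
  have := H.Tq_markov
  have := H.Tx_markov
  exact Kernel.IsMarkovKernel.map _ measurable_swap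

lemma likelihood_ne_top (s : HybridState X Q) (u : U) (y : Obs n Q) :
    H.likelihood s u y ≠ ∞ := by
  refine ENNReal.div_ne_top (ENNReal.mul_ne_top ENNReal.coe_ne_top ENNReal.coe_ne_top)
    (mul_ne_zero (by simpa using (H.φ_pos y.1).ne') ?_)
  simp

lemma likelihood_ne_zero (s : HybridState X Q) (u : U) (y : Obs n Q) :
    H.likelihood s u y ≠ 0 := by
  have : Nonempty Q := ⟨s.2⟩
  refine ENNReal.div_ne_zero.2 ⟨mul_ne_zero (by simpa using (H.φ_pos _).ne')
    (by simpa using (H.Qobs_pos _ _ _).ne'), ENNReal.mul_ne_top ENNReal.coe_ne_top ?_⟩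
  simp

lemma measurable_likelihood [MeasurableSingletonClass Q] [OpensMeasurableSpace U]
    {α : Type*} [MeasurableSpace α] {s : α → HybridState X Q} {u : α → U} {y : α → Obs n Q}
    (hs : Measurable s) (hu : Measurable u) (hy : Measurable y) :
    Measurable fun a => H.likelihood (s a) (u a) (y a) := by
  have hh : Measurable fun a => H.h (s a).1 (u a) :=
    H.h_continuous.measurable.comp (hs.fst.prodMk hu)
  have hQ : Measurable fun p : (Q × Q) × U => H.Qobs p.1.1 p.1.2 p.2 :=
    measurable_from_prod_countable_right fun q => H.Qobs_measurable q.1 q.2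
  have hQ' : Measurable fun a => H.Qobs (s a).2 (y a).2 (u a) :=
    hQ.comp ((hs.snd.prodMk hy.snd).prodMk hu)
  have hφ := H.φ_measurable
  unfold likelihood
  fun_prop

/-- The law of an observation under the changed measure: it does not depend on state or control,
its continuous part has the density `φ` and its discrete part is uniform. -/
def refObs : Measure (Obs n Q) :=
  (volume.withDensity fun v => (H.φ v : ℝ≥0∞)).prod
    (∑ j : Q, (1 / (Fintype.card Q : ℝ≥0∞)) • Measure.dirac j)

instance : IsProbabilityMeasure (volume.withDensity fun v => (H.φ v : ℝ≥0∞)) :=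
  ⟨by simpa using H.φ_lintegral⟩

lemma isFiniteMeasure_sum_dirac (c : Q → ℝ≥0) :
    IsFiniteMeasure (∑ j : Q, (c j : ℝ≥0∞) • Measure.dirac j) :=
  ⟨by simp [Measure.finsetSum_apply, ENNReal.sum_lt_top]⟩

lemma isProbabilityMeasure_uniform [Nonempty Q] :
    IsProbabilityMeasure (∑ j : Q, (1 / (Fintype.card Q : ℝ≥0∞)) • Measure.dirac j) :=
  ⟨by simp [Measure.finsetSum_apply, ENNReal.mul_inv_cancel]⟩

instance [Nonempty Q] : IsProbabilityMeasure H.refObs := by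
  have := isProbabilityMeasure_uniform (Q := Q)
  unfold refObs
  infer_instance

lemma lintegral_refObs [MeasurableSingletonClass Q] [Nonempty Q] {g : Obs n Q → ℝ≥0∞}
    (hg : Measurable g) :
    ∫⁻ y, g y ∂H.refObs =
      ∑ j : Q, ∫⁻ v : Rn n, g (v, j) * (1 / (Fintype.card Q : ℝ≥0∞)) * (H.φ v : ℝ≥0∞) := by
  have := isProbabilityMeasure_uniform (Q := Q)
  have hφ := H.φ_measurable
  rw [refObs, lintegral_prod_symm _ hg.aemeasurable, lintegral_finsetSum_measure]
  refine Finset.sum_congr rfl fun j _ => ?_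
  rw [lintegral_smul_measure, lintegral_dirac,
    lintegral_withDensity_eq_lintegral_mul _ (by fun_prop) (by fun_prop), smul_eq_mul,
    ← lintegral_const_mul _ (by fun_prop)]
  refine lintegral_congr fun v => ?_
  simp only [Pi.mul_apply]
  ring

lemma lintegral_obsLaw [MeasurableSingletonClass Q] (s : HybridState X Q) (u : U)
    {g : Obs n Q → ℝ≥0∞} (hg : Measurable g) :
    ∫⁻ y, g y ∂H.obsLaw s u =
      ∑ j : Q, ∫⁻ v : Rn n, (H.φ (v - H.h s.1 u) : ℝ≥0∞) * H.Qobs s.2 j u * g (v, j) := by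
  have := isFiniteMeasure_sum_dirac fun j : Q => H.Qobs s.2 j u
  have hφ := H.φ_measurable
  have hm : Measurable fun v : Rn n => H.h s.1 u + v := by fun_prop
  have := Measure.isProbabilityMeasure_map
    (μ := volume.withDensity fun v => (H.φ v : ℝ≥0∞)) hm.aemeasurable
  rw [obsLaw, lintegral_prod_symm _ hg.aemeasurable, lintegral_finsetSum_measure]
  refine Finset.sum_congr rfl fun j _ => ?_
  rw [lintegral_smul_measure, lintegral_dirac, lintegral_map (by fun_prop) hm,
    lintegral_withDensity_eq_lintegral_mul _ (by fun_prop) (by fun_prop), smul_eq_mul,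
    ← lintegral_const_mul _ (by fun_prop),
    ← lintegral_add_left_eq_self (fun v => _ * _ * g (v, j)) (H.h s.1 u)]
  refine lintegral_congr fun v => ?_
  simp only [Pi.mul_apply, add_sub_cancel_left]
  ring

/-- The likelihood ratio is the density of the true observation law with respect to the reference
law. -/
lemma obsLaw_eq_withDensity [MeasurableSingletonClass Q] [OpensMeasurableSpace U]
    (s : HybridState X Q) (u : U) :
    H.obsLaw s u = H.refObs.withDensity (H.likelihood s u) := by
  have : Nonempty Q := ⟨s.2⟩
  have hL : Measurable (H.likelihood s u) :=
    H.measurable_likelihood measurable_const measurable_const measurable_id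
  refine Measure.ext_of_lintegral _ fun g hg => ?_
  rw [lintegral_withDensity_eq_lintegral_mul _ hL hg, lintegral_refObs H (hL.mul hg),
    lintegral_obsLaw H s u hg]
  refine Finset.sum_congr rfl fun j _ => lintegral_congr fun v => ?_
  have h0 : (H.φ v : ℝ≥0∞) ≠ 0 := by simpa using (H.φ_pos v).ne'
  have hN : (1 / (Fintype.card Q : ℝ≥0∞)) ≠ 0 := by simp
  have hN' : (1 / (Fintype.card Q : ℝ≥0∞)) ≠ ∞ := by simp
  have key := ENNReal.div_mul_cancel (b := (H.φ (v - H.h s.1 u) : ℝ≥0∞) * H.Qobs s.2 j u)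
    (mul_ne_zero h0 hN) (ENNReal.mul_ne_top ENNReal.coe_ne_top hN')
  calc (H.φ (v - H.h s.1 u) : ℝ≥0∞) * H.Qobs s.2 j u * g (v, j)
      = H.likelihood s u (v, j) * ((H.φ v : ℝ≥0∞) * (1 / (Fintype.card Q : ℝ≥0∞))) * g (v, j) := by
        rw [likelihood, key]
    _ = _ := by rw [Pi.mul_apply]; ring

/-! ### State trajectories with controls held fixed -/

section FixedControls

variable (ρ : Measure (HybridState X Q))
  (K : Set (HybridState X Q))

lemma lintegral_pathLaw_zero (u : Fin 0 → U) {g : (Fin 1 → HybridState X Q) → ℝ≥0∞}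
    (hg : Measurable g) : ∫⁻ s, g s ∂H.pathLaw ρ 0 u = ∫⁻ s, g (fun _ => s) ∂ρ := by
  rw [pathLaw, lintegral_map hg (by fun_prop)]

lemma lintegral_pathLaw_succ (k : ℕ) (u : Fin (k + 1) → U)
    {g : (Fin (k + 2) → HybridState X Q) → ℝ≥0∞} (hg : Measurable g) :
    ∫⁻ s, g s ∂H.pathLaw ρ (k + 1) u =
      ∫⁻ s, ∫⁻ s', g (Fin.snoc (α := fun _ => HybridState X Q) s s')
        ∂H.τ (s (Fin.last k), u (Fin.last k))
        ∂H.pathLaw ρ k (Fin.init (α := fun _ => U) u) := by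
  rw [pathLaw, Measure.lintegral_bind _ hg.aemeasurable]
  · refine lintegral_congr fun s => ?_
    exact lintegral_map hg (measurable_const.snoc measurable_id)
  · exact (measurable_kernel_map H.τ (by fun_prop) (measurable_snoc _)).aemeasurable

lemma measurable_pathLaw_and_isProbabilityMeasure [IsProbabilityMeasure ρ] (k : ℕ) :
    Measurable (H.pathLaw ρ k) ∧ ∀ u, IsProbabilityMeasure (H.pathLaw ρ k u) := by
  induction k with
  | zero =>
    refine ⟨measurable_const, fun u => Measure.isProbabilityMeasure_map (by fun_prop)⟩
  | succ k ih =>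
    obtain ⟨hm, hp⟩ := ih
    let κ : Kernel (Fin k → U) (Fin (k + 1) → HybridState X Q) := ⟨H.pathLaw ρ k, hm⟩
    have : IsMarkovKernel κ := ⟨hp⟩
    constructor
    · refine measurable_of_measurable_lintegral fun g hg => ?_
      simp_rw [lintegral_pathLaw_succ H ρ k _ hg]
      refine measurable_lintegral_kernel_comp κ (measurable_init k) ?_
      refine measurable_lintegral_kernel_comp H.τ
        (g := fun p : (Fin (k + 1) → U) × (Fin (k + 1) → HybridState X Q) =>
          (p.2 (Fin.last k), p.1 (Fin.last k))) (by fun_prop) ?_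
      exact hg.comp ((measurable_snd.comp measurable_fst).snoc measurable_snd)
    · refine fun u => ⟨?_⟩
      have := hp (Fin.init (α := fun _ => U) u)
      rw [← lintegral_one, lintegral_pathLaw_succ H ρ k _ measurable_const]
      simp

/-- The law of the state trajectory as a kernel from the control sequences. -/
def pathKernel [IsProbabilityMeasure ρ] (k : ℕ) :
    Kernel (Fin k → U) (Fin (k + 1) → HybridState X Q) :=
  ⟨H.pathLaw ρ k, (H.measurable_pathLaw_and_isProbabilityMeasure ρ k).1⟩

instance [IsProbabilityMeasure ρ] (k : ℕ) : IsMarkovKernel (H.pathKernel ρ k) :=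
  ⟨(H.measurable_pathLaw_and_isProbabilityMeasure ρ k).2⟩

instance [IsProbabilityMeasure ρ] (k : ℕ) (u : Fin k → U) :
    IsProbabilityMeasure (H.pathLaw ρ k u) :=
  (H.measurable_pathLaw_and_isProbabilityMeasure ρ k).2 u

lemma measurable_lintegral_pathLaw [IsProbabilityMeasure ρ] {α : Type*} [MeasurableSpace α] {k : ℕ}
    {u : α → Fin k → U} (hu : Measurable u) {f : α → (Fin (k + 1) → HybridState X Q) → ℝ≥0∞}
    (hf : Measurable (Function.uncurry f)) :
    Measurable fun a => ∫⁻ s, f a s ∂H.pathLaw ρ k (u a) :=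
  measurable_lintegral_kernel_comp (H.pathKernel ρ k) hu hf

/-- Integration over the last state commutes with integration over an independent variable. -/
lemma lintegral_pathLaw_snoc [IsProbabilityMeasure ρ] {k : ℕ} (c : Fin k → U) (u : U)
    {α : Type*} [MeasurableSpace α] (ν : Measure α) [SFinite ν]
    {g : (Fin (k + 2) → HybridState X Q) → α → ℝ≥0∞} (hg : Measurable (Function.uncurry g)) :
    ∫⁻ y, ∫⁻ s, g s y ∂H.pathLaw ρ (k + 1) (Fin.snoc (α := fun _ => U) c u) ∂ν =
      ∫⁻ s, ∫⁻ s', ∫⁻ y, g (Fin.snoc (α := fun _ => HybridState X Q) s s') y ∂ν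
        ∂H.τ (s (Fin.last k), u) ∂H.pathLaw ρ k c := by
  rw [lintegral_lintegral_swap (f := fun y s => g s y) (hg.comp measurable_swap).aemeasurable]
  refine (H.lintegral_pathLaw_succ ρ k _ hg.lintegral_prod_right').trans ?_
  simp only [Fin.snoc_last, Fin.init_snoc, Function.uncurry_apply_pair]

/-! ### The information state and its recursion -/

/-- The information vector `i_{k+1}`, obtained from `i_k` by appending `y_{k+1}` and `u_k`. -/
def extendInfo {k : ℕ} (i : Info n Q U k) (y : Obs n Q) (u : U) : Info n Q U (k + 1) :=
  (Fin.snoc (α := fun _ => Obs n Q) i.1 y, Fin.snoc (α := fun _ => U) i.2 u)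

omit [Fintype Q] [TopologicalSpace U] in
lemma measurable_extendInfo {α : Type*} [MeasurableSpace α] {k : ℕ} {i : α → Info n Q U k}
    {y : α → Obs n Q} {u : α → U} (hi : Measurable i) (hy : Measurable y) (hu : Measurable u) :
    Measurable fun a => extendInfo (i a) (y a) (u a) :=
  (hi.fst.snoc hy).prodMk (hi.snd.snoc hu)

lemma Lam_ne_top (k : ℕ) (s : Fin (k + 1) → HybridState X Q) (i : Info n Q U k) :
    H.Lam k s i ≠ ∞ :=
  ENNReal.prod_ne_top fun _ _ => H.likelihood_ne_top _ _ _

lemma Lam_ne_zero (k : ℕ) (s : Fin (k + 1) → HybridState X Q) (i : Info n Q U k) :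
    H.Lam k s i ≠ 0 :=
  Finset.prod_ne_zero_iff.2 fun _ _ => H.likelihood_ne_zero _ _ _

lemma Lam_extend {k : ℕ} (s : Fin (k + 1) → HybridState X Q) (s' : HybridState X Q)
    (i : Info n Q U k) (y : Obs n Q) (u : U) :
    H.Lam (k + 1) (Fin.snoc (α := fun _ => HybridState X Q) s s') (extendInfo i y u) =
      H.Lam k s i * H.likelihood s' u y := by
  simp only [Lam, extendInfo, Fin.prod_univ_castSucc, Fin.snoc_castSucc, Fin.snoc_last,
    ← Fin.castSucc_succ, Fin.succ_last]

omit [Fintype Q] [MeasurableSpace Q] in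
lemma safeBefore_snoc {k : ℕ} (s : Fin (k + 1) → HybridState X Q) (s' : HybridState X Q) :
    safeBefore K (k + 1) (Fin.snoc (α := fun _ => HybridState X Q) s s') =
      safeBefore K k s * K.indicator (fun _ => (1 : ℝ≥0∞)) (s (Fin.last k)) := by
  simp only [safeBefore, Fin.prod_univ_castSucc, Fin.snoc_castSucc]

omit [Fintype Q] [MeasurableSpace Q] in
lemma safeBefore_le_one (k : ℕ) (s : Fin (k + 1) → HybridState X Q) : safeBefore K k s ≤ 1 :=
  Finset.prod_le_one' fun _ _ => Set.indicator_le_self' (by simp) _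

variable {K} in
omit [Fintype Q] in
lemma measurable_safeBefore (hK : MeasurableSet K) (k : ℕ) : Measurable (safeBefore K k) :=
  Finset.measurable_fun_prod _ fun l _ =>
    (measurable_const.indicator hK).comp (measurable_pi_apply l.castSucc)

variable [MeasurableSingletonClass Q] [OpensMeasurableSpace U]

lemma measurable_Lam {α : Type*} [MeasurableSpace α] {k : ℕ}
    {s : α → Fin (k + 1) → HybridState X Q} {i : α → Info n Q U k} (hs : Measurable s)
    (hi : Measurable i) : Measurable fun a => H.Lam k (s a) (i a) := by
  refine Finset.measurable_fun_prod _ fun l _ => H.measurable_likelihood ?_ ?_ ?_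
  · exact (measurable_pi_apply l.succ).comp hs
  · exact (measurable_pi_apply l).comp hi.snd
  · exact (measurable_pi_apply l).comp hi.fst

lemma lintegral_eta (hK : MeasurableSet K) (k : ℕ) (i : Info n Q U k)
    {g : HybridState X Q → ℝ≥0∞} (hg : Measurable g) :
    ∫⁻ s, g s ∂H.eta ρ K k i =
      ∫⁻ s, safeBefore K k s * H.Lam k s i * g (s (Fin.last k)) ∂H.pathLaw ρ k i.2 := by
  have hL : Measurable fun s => safeBefore K k s * H.Lam k s i :=
    (measurable_safeBefore hK k).mul (H.measurable_Lam measurable_id measurable_const)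
  rw [eta, lintegral_map hg (by fun_prop), lintegral_withDensity_eq_lintegral_mul _ hL
    (by fun_prop)]
  rfl

/-- The formula for `η_k` as an integral over paths gives its measurability without finiteness:
`η_k` may be infinite for a null set of observations. -/
lemma measurable_eta [IsProbabilityMeasure ρ] (hK : MeasurableSet K) (k : ℕ) :
    Measurable (H.eta (U := U) ρ K k) := by
  refine measurable_of_measurable_lintegral fun g hg => ?_
  simp_rw [H.lintegral_eta ρ K hK k _ hg]
  refine H.measurable_lintegral_pathLaw ρ measurable_snd ?_
  exact (((measurable_safeBefore hK k).comp measurable_snd).mul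
    (H.measurable_Lam measurable_snd measurable_fst)).mul (by fun_prop)

lemma eta_zero (hK : MeasurableSet K) (i : Info n Q U 0) : H.eta ρ K 0 i = ρ := by
  refine Measure.ext_of_lintegral _ fun g hg => ?_
  rw [H.lintegral_eta ρ K hK 0 i hg]
  simp only [safeBefore, Lam, Finset.univ_eq_empty, Finset.prod_empty, one_mul]
  exact H.lintegral_pathLaw_zero ρ _ (by fun_prop)

lemma lintegral_T (hK : MeasurableSet K) (u : U) (y : Obs n Q) (σ : Measure (HybridState X Q))
    {g : HybridState X Q → ℝ≥0∞} (hg : Measurable g) :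
    ∫⁻ s, g s ∂H.T K u y σ =
      ∫⁻ s, K.indicator (fun _ => (1 : ℝ≥0∞)) s *
        ∫⁻ s', H.likelihood s' u y * g s' ∂H.τ (s, u) ∂σ := by
  have hL : Measurable fun s' => H.likelihood s' u y :=
    H.measurable_likelihood measurable_id measurable_const measurable_const
  have hτ : Measurable fun s => H.τ (s, u) := H.τ.measurable.comp (by fun_prop)
  rw [T, lintegral_withDensity_eq_lintegral_mul _ hL hg, 
    Measure.lintegral_bind hτ.aemeasurable (hL.mul hg).aemeasurable, ← lintegral_indicator hK]
  refine lintegral_congr fun s => ?_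
  by_cases hs : s ∈ K <;> simp [hs]

/-- The recursion `σ_{k+1} = T_{u_k, y_{k+1}}[σ_k]` of the information state. -/
lemma eta_extend (hK : MeasurableSet K) {k : ℕ} (i : Info n Q U k) (y : Obs n Q) (u : U) :
    H.eta ρ K (k + 1) (extendInfo i y u) = H.T K u y (H.eta ρ K k i) := by
  refine Measure.ext_of_lintegral _ fun g hg => ?_
  have hL : Measurable fun s' => H.likelihood s' u y :=
    H.measurable_likelihood measurable_id measurable_const measurable_const
  have hLg : Measurable fun s' => H.likelihood s' u y * g s' := hL.mul hg
  have hin : Measurable fun s => ∫⁻ s', H.likelihood s' u y * g s' ∂H.τ (s, u) :=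
    measurable_lintegral_kernel_comp H.τ (by fun_prop) (hLg.comp measurable_snd)
  have hin' : Measurable fun s => K.indicator (fun _ => (1 : ℝ≥0∞)) s *
      ∫⁻ s', H.likelihood s' u y * g s' ∂H.τ (s, u) := (measurable_const.indicator hK).mul hin
  rw [H.lintegral_eta ρ K hK _ _ hg, H.lintegral_T K hK u y _ hg,
    H.lintegral_eta ρ K hK k i hin', lintegral_pathLaw_succ]
  · simp only [extendInfo, Fin.snoc_last, Fin.init_snoc]
    refine lintegral_congr fun s => ?_
    rw [← mul_assoc, ← lintegral_const_mul _ hLg]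
    refine lintegral_congr fun s' => ?_
    have := H.Lam_extend s s' i y u
    rw [extendInfo] at this
    rw [this, safeBefore_snoc]
    ring
  · exact ((measurable_safeBefore hK _).mul (H.measurable_Lam measurable_id measurable_const)).mul
      (by fun_prop)

end FixedControls

/-! ### Disintegration of the trajectory law along the information vector -/

section RefLaw

variable (ρ : Measure (HybridState X Q))
  (K : Set (HybridState X Q))

/-- The law of `i_k` under the changed measure: the observations are i.i.d. with law `refObs`. -/
def refInfo (H : PODTSHS X Q U) (π : Policy n Q U) : (k : ℕ) → Measure (Info n Q U k)
  | 0 => Measure.dirac (Fin.elim0, Fin.elim0)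
  | k + 1 => (H.refInfo π k).bind fun i => H.refObs.map fun y => extendInfo i y (π k i)

variable {π : Policy n Q U}

lemma lintegral_refInfo_succ [Nonempty Q] (hπ : π ∈ admissible n Q U) (k : ℕ)
    {g : Info n Q U (k + 1) → ℝ≥0∞} (hg : Measurable g) :
    ∫⁻ i, g i ∂H.refInfo π (k + 1) =
      ∫⁻ i, ∫⁻ y, g (extendInfo i y (π k i)) ∂H.refObs ∂H.refInfo π k := by
  have hm : Measurable fun p : Info n Q U k × Obs n Q => extendInfo p.1 p.2 (π k p.1) :=
    measurable_extendInfo measurable_fst measurable_snd ((hπ k).comp measurable_fst)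
  have hb : Measurable fun i : Info n Q U k => H.refObs.map fun y => extendInfo i y (π k i) :=
    measurable_kernel_map (Kernel.const (Info n Q U k) H.refObs) measurable_id
      (f := fun i y => extendInfo i y (π k i)) hm
  rw [refInfo, Measure.lintegral_bind hb.aemeasurable hg.aemeasurable]
  refine lintegral_congr fun i => ?_
  exact lintegral_map hg (hm.of_uncurry_left (f := fun i y => extendInfo i y (π k i)))

lemma isProbabilityMeasure_refInfo [Nonempty Q] (hπ : π ∈ admissible n Q U) (k : ℕ) :
    IsProbabilityMeasure (H.refInfo π k) := by
  induction k with
  | zero => rw [refInfo]; infer_instance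
  | succ k ih =>
    refine ⟨?_⟩
    rw [← lintegral_one, H.lintegral_refInfo_succ hπ k measurable_const]
    simp

variable [MeasurableSingletonClass Q] [OpensMeasurableSpace U]

/-- The observation law as a kernel from the new state and the control. -/
def obsKernel [Nonempty Q] : Kernel (HybridState X Q × U) (Obs n Q) :=
  (Kernel.const _ H.refObs).withDensity fun p y => H.likelihood p.1 p.2 y

lemma obsKernel_apply [Nonempty Q] (p : HybridState X Q × U) :
    H.obsKernel p = H.obsLaw p.1 p.2 := by
  rw [obsKernel, Kernel.withDensity_apply, obsLaw_eq_withDensity]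
  · rfl
  · exact H.measurable_likelihood measurable_fst.fst measurable_fst.snd measurable_snd

instance [Nonempty Q] : IsSFiniteKernel H.obsKernel :=
  Kernel.IsSFiniteKernel.withDensity _ fun _ _ => H.likelihood_ne_top _ _ _

lemma lintegral_law_succ [Nonempty Q] (hπ : π ∈ admissible n Q U) (k : ℕ)
    {F : Traj X Q U (k + 1) → ℝ≥0∞} (hF : Measurable F) :
    ∫⁻ ω, F ω ∂H.law ρ π (k + 1) =
      ∫⁻ ω, ∫⁻ s', ∫⁻ y, H.likelihood s' (π k ω.2) y *
          F (Fin.snoc (α := fun _ => HybridState X Q) ω.1 s', extendInfo ω.2 y (π k ω.2))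
        ∂H.refObs ∂H.τ (ω.1 (Fin.last k), π k ω.2) ∂H.law ρ π k := by
  have hu : Measurable fun ω : Traj X Q U k => π k ω.2 := (hπ k).comp measurable_snd
  have hf : Measurable fun p : (Traj X Q U k × HybridState X Q) × Obs n Q =>
      ((Fin.snoc (α := fun _ => HybridState X Q) p.1.1.1 p.1.2,
        extendInfo p.1.1.2 p.2 (π k p.1.1.2)) : Traj X Q U (k + 1)) :=
    (measurable_fst.fst.fst.snoc measurable_fst.snd).prodMk
      (measurable_extendInfo measurable_fst.fst.snd measurable_snd (hu.comp measurable_fst.fst))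
  have hm : Measurable fun p : Traj X Q U k × HybridState X Q =>
      (H.obsLaw p.2 (π k p.1.2)).map fun y =>
        ((Fin.snoc (α := fun _ => HybridState X Q) p.1.1 p.2,
          extendInfo p.1.2 y (π k p.1.2)) : Traj X Q U (k + 1)) := by
    have := measurable_kernel_map H.obsKernel (g := fun p : Traj X Q U k × HybridState X Q =>
      (p.2, π k p.1.2)) (measurable_snd.prodMk (hu.comp measurable_fst)) (f := fun p y =>
        ((Fin.snoc (α := fun _ => HybridState X Q) p.1.1 p.2,
          extendInfo p.1.2 y (π k p.1.2)) : Traj X Q U (k + 1))) hf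
    simpa only [obsKernel_apply] using this
  have hb := measurable_kernel_bind H.τ (g := fun ω : Traj X Q U k => (ω.1 (Fin.last k), π k ω.2))
    (((measurable_pi_apply _).comp measurable_fst).prodMk hu) (m := fun ω s' =>
      (H.obsLaw s' (π k ω.2)).map fun y =>
        ((Fin.snoc (α := fun _ => HybridState X Q) ω.1 s',
          extendInfo ω.2 y (π k ω.2)) : Traj X Q U (k + 1))) hm
  rw [law]
  refine (Measure.lintegral_bind hb.aemeasurable hF.aemeasurable).trans ?_
  refine lintegral_congr fun ω => ?_
  have hm' : Measurable fun s' => (H.obsLaw s' (π k ω.2)).map fun y =>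
        ((Fin.snoc (α := fun _ => HybridState X Q) ω.1 s',
          extendInfo ω.2 y (π k ω.2)) : Traj X Q U (k + 1)) :=
    hm.comp (measurable_const.prodMk measurable_id : Measurable fun s' => (ω, s'))
  rw [Measure.lintegral_bind hm'.aemeasurable hF.aemeasurable]
  refine lintegral_congr fun s' => ?_
  have hf' : Measurable fun y : Obs n Q => ((Fin.snoc (α := fun _ => HybridState X Q) ω.1 s',
      extendInfo ω.2 y (π k ω.2)) : Traj X Q U (k + 1)) :=
    hf.comp (measurable_const.prodMk measurable_id : Measurable fun y => ((ω, s'), y))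
  have hL : Measurable (H.likelihood s' (π k ω.2)) :=
    H.measurable_likelihood measurable_const measurable_const measurable_id
  rw [lintegral_map hF hf', obsLaw_eq_withDensity]
  exact lintegral_withDensity_eq_lintegral_mul _ hL (hF.comp hf')

/-- Bayes' formula: a trajectory is obtained by drawing the information vector from its reference
law and then the states from their law under the controls of that vector, with weight `Λ_k`. -/
lemma lintegral_law [Nonempty Q] [IsProbabilityMeasure ρ] (hπ : π ∈ admissible n Q U) (k : ℕ)
    {F : Traj X Q U k → ℝ≥0∞} (hF : Measurable F) :
    ∫⁻ ω, F ω ∂H.law ρ π k =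
      ∫⁻ i, ∫⁻ s, H.Lam k s i * F (s, i) ∂H.pathLaw ρ k i.2 ∂H.refInfo π k := by
  induction k with
  | zero =>
    have hLF : Measurable fun p : Info n Q U 0 × (Fin 1 → HybridState X Q) =>
        H.Lam 0 p.2 p.1 * F (p.2, p.1) :=
      (H.measurable_Lam measurable_snd measurable_fst).mul (hF.comp measurable_swap)
    rw [law, refInfo, lintegral_map hF (by fun_prop),
      lintegral_dirac' _ (H.measurable_lintegral_pathLaw ρ measurable_snd hLF)]
    refine .trans ?_ (H.lintegral_pathLaw_zero ρ _ (hLF.comp (by fun_prop :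
      Measurable fun s : Fin 1 → HybridState X Q => ((Fin.elim0, Fin.elim0), s)))).symm
    simp [Lam]
  | succ k ih =>
    have hu : Measurable fun ω : Traj X Q U k => π k ω.2 := (hπ k).comp measurable_snd
    -- the integrand after one step, as a function of `(s, i)`, the new state and observation
    have hG : Measurable fun p : (Traj X Q U k × HybridState X Q) × Obs n Q =>
        H.likelihood p.1.2 (π k p.1.1.2) p.2 *
          F (Fin.snoc (α := fun _ => HybridState X Q) p.1.1.1 p.1.2,
            extendInfo p.1.1.2 p.2 (π k p.1.1.2)) :=
      (H.measurable_likelihood measurable_fst.snd (hu.comp measurable_fst.fst)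
        measurable_snd).mul (hF.comp ((measurable_fst.fst.fst.snoc measurable_fst.snd).prodMk
      (measurable_extendInfo measurable_fst.fst.snd measurable_snd (hu.comp measurable_fst.fst))))
    have hLF : Measurable fun p : Info n Q U (k + 1) × (Fin (k + 2) → HybridState X Q) =>
        H.Lam (k + 1) p.2 p.1 * F (p.2, p.1) :=
      (H.measurable_Lam measurable_snd measurable_fst).mul (hF.comp measurable_swap)
    have hτ : Measurable fun ω : Traj X Q U k => (ω.1 (Fin.last k), π k ω.2) :=
      ((measurable_pi_apply _).comp measurable_fst).prodMk hu
    rw [H.lintegral_law_succ ρ hπ k hF, ih, H.lintegral_refInfo_succ hπ k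
      (H.measurable_lintegral_pathLaw ρ measurable_snd
        (f := fun i s => H.Lam (k + 1) s i * F (s, i)) hLF)]
    · refine lintegral_congr fun i => ?_
      have hLF' : Measurable fun p : (Fin (k + 2) → HybridState X Q) × Obs n Q =>
          H.Lam (k + 1) p.1 (extendInfo i p.2 (π k i)) * F (p.1, extendInfo i p.2 (π k i)) := by
        have hi : Measurable fun p : (Fin (k + 2) → HybridState X Q) × Obs n Q =>
            extendInfo i p.2 (π k i) :=
          measurable_extendInfo measurable_const measurable_snd measurable_const
        exact (H.measurable_Lam measurable_fst hi).mul (hF.comp (measurable_fst.prodMk hi))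
      refine .trans ?_ (H.lintegral_pathLaw_snoc ρ i.2 (π k i) H.refObs (g := fun s y =>
        H.Lam (k + 1) s (extendInfo i y (π k i)) * F (s, extendInfo i y (π k i))) hLF').symm
      refine lintegral_congr fun s => ?_
      rw [← lintegral_const_mul' _ _ (H.Lam_ne_top k s i)]
      refine lintegral_congr fun s' => ?_
      rw [← lintegral_const_mul' _ _ (H.Lam_ne_top k s i)]
      simp only [Lam_extend, mul_assoc]
    · refine measurable_lintegral_kernel_comp H.τ hτ ?_
      exact Measurable.lintegral_prod_right' hG

/-- Under the changed measure, the information vector has law `refInfo` and the states have,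
conditionally on it, the law `pathLaw` under its controls. -/
lemma lintegral_refLaw [Nonempty Q] [IsProbabilityMeasure ρ] (hπ : π ∈ admissible n Q U) (k : ℕ)
    {F : Traj X Q U k → ℝ≥0∞} (hF : Measurable F) :
    ∫⁻ ω, F ω ∂H.refLaw ρ π k =
      ∫⁻ i, ∫⁻ s, F (s, i) ∂H.pathLaw ρ k i.2 ∂H.refInfo π k := by
  have hL : Measurable fun ω : Traj X Q U k => (H.Lam k ω.1 ω.2)⁻¹ :=
    (H.measurable_Lam measurable_fst measurable_snd).inv
  rw [refLaw, lintegral_withDensity_eq_lintegral_mul _ hL hF, H.lintegral_law ρ hπ k (hL.mul hF)]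
  refine lintegral_congr fun i => lintegral_congr fun s => ?_
  rw [Pi.mul_apply, ← mul_assoc, ENNReal.mul_inv_cancel (H.Lam_ne_zero k s i) (H.Lam_ne_top k s i),
    one_mul]

lemma isProbabilityMeasure_refLaw [Nonempty Q] [IsProbabilityMeasure ρ]
    (hπ : π ∈ admissible n Q U) (k : ℕ) : IsProbabilityMeasure (H.refLaw ρ π k) := by
  have := H.isProbabilityMeasure_refInfo hπ k
  refine ⟨?_⟩
  rw [← lintegral_one, H.lintegral_refLaw ρ hπ k measurable_const]
  simp

end RefLaw

/-! ### The dynamic programming equation -/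

section DynamicProgramming

variable (ρ : Measure (HybridState X Q))
  {K : Set (HybridState X Q)}

section ValueFunction

variable {N : ℕ} {Sig : ℕ → Set (Measure (HybridState X Q))} {μbar : InfoPolicy X Q U}

lemma optValue_self (σ : Measure (HybridState X Q)) : H.optValue K N N σ = σ K := by
  simp [optValue, valueToGo]

lemma optValue_eq_iSup {k : ℕ} (hk : k < N) (σ : Measure (HybridState X Q)) :
    H.optValue K N k σ = ⨆ u, H.expectedNext K (H.optValue K N (k + 1)) σ u := by
  rw [optValue, show N - k = N - (k + 1) + 1 by omega, valueToGo]
  rfl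

lemma optValue_eq_expectedNext (hopt : H.IsDPOptimal K N Sig μbar) {k : ℕ} (hk : k < N)
    {σ : Measure (HybridState X Q)} (hσ : σ ∈ Sig k) :
    H.optValue K N k σ = H.expectedNext K (H.optValue K N (k + 1)) σ (μbar k σ) := by
  rw [optValue_eq_iSup H hk]
  exact le_antisymm (iSup_le (hopt k hk σ hσ))
    (le_iSup (fun u => H.expectedNext K (H.optValue K N (k + 1)) σ u) _)

lemma expectedNext_congr {ρ : Measure (HybridState X Q)}
    (hSig : H.IsInfoStateSpace ρ K N Sig) {k : ℕ} (hk : k < N)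
    {V W : Measure (HybridState X Q) → ℝ≥0∞} (hVW : ∀ σ ∈ Sig (k + 1), V σ = W σ)
    {σ : Measure (HybridState X Q)} (hσ : σ ∈ Sig k) (u : U) :
    H.expectedNext K V σ u = H.expectedNext K W σ u := by
  refine Finset.sum_congr rfl fun j _ => lintegral_congr_ae ?_
  filter_upwards [hSig.step k hk σ hσ u j] with v hv
  rw [hVW _ hv]

end ValueFunction

variable {π : Policy n Q U} [MeasurableSingletonClass Q] [OpensMeasurableSpace U]

/-! ### The information state as a conditional expectation -/

lemma lintegral_likelihood [Nonempty Q] (s : HybridState X Q) (u : U) :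
    ∫⁻ y, H.likelihood s u y ∂H.refObs = 1 := by
  have hsum : IsProbabilityMeasure (∑ j : Q, (H.Qobs s.2 j u : ℝ≥0∞) • Measure.dirac j) := by
    refine ⟨?_⟩
    simp only [Measure.finsetSum_apply, Measure.smul_apply, measure_univ, smul_eq_mul, mul_one]
    exact_mod_cast H.Qobs_sum s.2 u
  have hm : Measurable fun v : Rn n => H.h s.1 u + v := by fun_prop
  have hmap := Measure.isProbabilityMeasure_map
    (μ := volume.withDensity fun v => (H.φ v : ℝ≥0∞)) hm.aemeasurable
  have : H.obsLaw s u Set.univ = 1 := by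
    rw [obsLaw]
    exact measure_univ
  rwa [obsLaw_eq_withDensity, withDensity_apply _ MeasurableSet.univ,
    Measure.restrict_univ] at this

lemma isProbabilityMeasure_law [Nonempty Q] [IsProbabilityMeasure ρ] (hπ : π ∈ admissible n Q U)
    (k : ℕ) : IsProbabilityMeasure (H.law ρ π k) := by
  induction k with
  | zero => exact Measure.isProbabilityMeasure_map (by fun_prop)
  | succ k ih =>
    refine ⟨?_⟩
    rw [← lintegral_one, H.lintegral_law_succ ρ hπ k measurable_const]
    simp [lintegral_likelihood]

/-- `Λ_k` is a probability density with respect to the changed measure. -/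
lemma lintegral_Lam_refLaw [Nonempty Q] [IsProbabilityMeasure ρ] (hπ : π ∈ admissible n Q U)
    (k : ℕ) : ∫⁻ ω, H.Lam k ω.1 ω.2 ∂H.refLaw ρ π k = 1 := by
  have := H.isProbabilityMeasure_law ρ hπ k
  rw [H.lintegral_refLaw ρ hπ k (H.measurable_Lam measurable_fst measurable_snd)]
  have h := H.lintegral_law ρ hπ k (F := fun _ => 1) measurable_const
  simpa using h.symm

theorem etaIsCondExp [Nonempty Q] [IsProbabilityMeasure ρ]
    (hK : MeasurableSet K) (hπ : π ∈ admissible n Q U) (k : ℕ) : H.EtaIsCondExp ρ K π k := by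
  intro B hB
  have := H.isProbabilityMeasure_refLaw ρ hπ k
  have hm : MeasurableSpace.comap (fun ω : Traj X Q U k => ω.2) inferInstance ≤
      Prod.instMeasurableSpace := measurable_snd.comap_le
  set F : Traj X Q U k → ℝ≥0∞ := fun ω =>
    B.indicator (fun _ => (1 : ℝ≥0∞)) (ω.1 (Fin.last k)) * safeBefore K k ω.1 * H.Lam k ω.1 ω.2
    with hFdef
  set G : Info n Q U k → ℝ≥0∞ := fun i => H.eta ρ K k i B with hGdef
  have hB1 : Measurable fun s => B.indicator (fun _ => (1 : ℝ≥0∞)) s :=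
    measurable_const.indicator hB
  have hF : Measurable F :=
    ((hB1.comp ((measurable_pi_apply (Fin.last k)).comp measurable_fst)).mul
      ((measurable_safeBefore hK k).comp measurable_fst)).mul
      (H.measurable_Lam measurable_fst measurable_snd)
  have hG : Measurable G := (Measure.measurable_coe hB).comp (H.measurable_eta ρ K hK k)
  have hG2 : Measurable fun ω : Traj X Q U k => G ω.2 := hG.comp measurable_snd
  have hGF : ∀ i, G i = ∫⁻ s, F (s, i) ∂H.pathLaw ρ k i.2 := by
    intro i
    have h := H.lintegral_eta ρ K hK k i hB1
    rw [lintegral_indicator_const hB, one_mul] at h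
    rw [hGdef]
    refine h.trans (lintegral_congr fun s => ?_)
    simp only [hFdef]
    ring
  have hFtop : ∫⁻ ω, F ω ∂H.refLaw ρ π k ≠ ∞ := by
    refine ne_top_of_le_ne_top ENNReal.one_ne_top
      ((lintegral_mono fun ω => ?_).trans_eq (H.lintegral_Lam_refLaw ρ hπ k))
    refine mul_le_of_le_one_left' (mul_le_one' (Set.indicator_le_self' (by simp) _) ?_)
    exact safeBefore_le_one K k _
  -- on sets determined by the information vector, `F` and `G` have the same integral
  have hset : ∀ C : Set (Info n Q U k), MeasurableSet C →
      ∫⁻ ω in Prod.snd ⁻¹' C, G ω.2 ∂H.refLaw ρ π k =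
        ∫⁻ ω in Prod.snd ⁻¹' C, F ω ∂H.refLaw ρ π k := by
    intro C hC
    have hC' : MeasurableSet (Prod.snd ⁻¹' C : Set (Traj X Q U k)) := measurable_snd hC
    rw [← lintegral_indicator hC', ← lintegral_indicator hC',
      H.lintegral_refLaw ρ hπ k (hF.indicator hC'),
      H.lintegral_refLaw ρ hπ k (hG2.indicator hC')]
    refine lintegral_congr fun i => ?_
    by_cases hi : i ∈ C
    · simp [Set.indicator, hi, hGF]
    · simp [Set.indicator, hi]
  have hGtop : ∫⁻ ω, G ω.2 ∂H.refLaw ρ π k ≠ ∞ := by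
    have := hset Set.univ MeasurableSet.univ
    rw [Set.preimage_univ, Measure.restrict_univ] at this
    rwa [this]
  refine (ae_eq_condExp_of_forall_setIntegral_eq hm
    (integrable_toReal_of_lintegral_ne_top hF.aemeasurable hFtop)
    (fun s _ _ => (integrable_toReal_of_lintegral_ne_top hG2.aemeasurable hGtop).integrableOn)
    ?_ ?_).symm
  · rintro _ ⟨C, hC, rfl⟩ _
    rw [integral_toReal hG2.aemeasurable (ae_restrict_of_ae (ae_lt_top hG2 hGtop)),
      integral_toReal hF.aemeasurable (ae_restrict_of_ae (ae_lt_top hF hFtop))]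
    exact congrArg ENNReal.toReal (hset C hC)
  · have : Measurable[MeasurableSpace.comap (fun ω : Traj X Q U k => ω.2) inferInstance]
        fun ω : Traj X Q U k => (G ω.2).toReal :=
      hG.ennreal_toReal.comp (comap_measurable _)
    exact this.stronglyMeasurable.aestronglyMeasurable

/-! ### Rewards in terms of the reference law -/

/-- The weight `Λ_N` of the change of measure is absorbed by the information state, so the safety
probability is the expected final mass `σ_N(K)` under the reference law. -/
lemma safetyProb_eq [Nonempty Q] [IsProbabilityMeasure ρ] (hK : MeasurableSet K)
    (hπ : π ∈ admissible n Q U) (N : ℕ) :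
    H.safetyProb ρ K N π = ∫⁻ i, H.eta ρ K N i K ∂H.refInfo π N := by
  have hK1 : Measurable fun s => K.indicator (fun _ => (1 : ℝ≥0∞)) s :=
    measurable_const.indicator hK
  have hset : MeasurableSet {ω : Traj X Q U N | ∀ i, ω.1 i ∈ K} := by
    simp only [Set.ofPred_forall]
    exact MeasurableSet.iInter fun i => ((measurable_pi_apply i).comp measurable_fst) hK
  rw [safetyProb, ← lintegral_indicator_one hset,
    H.lintegral_law ρ hπ N (measurable_one.indicator hset)]
  refine lintegral_congr fun i => ?_
  have h := H.lintegral_eta ρ K hK N i hK1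
  rw [lintegral_indicator_const hK, one_mul] at h
  refine .trans (lintegral_congr fun s => ?_) h.symm
  have hprod : ({ω : Traj X Q U N | ∀ i, ω.1 i ∈ K} : Set _).indicator 1 (s, i) =
      ∏ l : Fin (N + 1), K.indicator (fun _ => (1 : ℝ≥0∞)) (s l) := by
    by_cases hs : ∀ l, s l ∈ K
    · simp [Set.indicator, hs]
    · obtain ⟨l, hl⟩ := not_forall.1 hs
      rw [Set.indicator_of_notMem (show (s, i) ∉ {ω : Traj X Q U N | ∀ i, ω.1 i ∈ K} from hs),
        Finset.prod_eq_zero (Finset.mem_univ l)]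
      simp [hl]
  rw [hprod, Fin.prod_univ_castSucc, safeBefore]
  ring

lemma infoReward_eq [Nonempty Q] [IsProbabilityMeasure ρ] (hK : MeasurableSet K) (N : ℕ)
    {μbar : InfoPolicy X Q U} (hμ : H.induced ρ K μbar ∈ admissible n Q U) :
    H.infoReward ρ K N μbar = ∫⁻ i, H.eta ρ K N i K ∂H.refInfo (H.induced ρ K μbar) N := by
  have hG : Measurable fun i : Info n Q U N => H.eta ρ K N i K :=
    (Measure.measurable_coe hK).comp (H.measurable_eta ρ K hK N)
  refine (H.lintegral_refLaw ρ hμ N (hG.comp measurable_snd)).trans ?_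
  simp

/-! ### Dynamic programming on the information state -/

/-- Joint measurability of `T_{u,y}[σ]` in `u`, `y` and a finite measure `σ`. -/
lemma measurable_T [Nonempty Q] (hK : MeasurableSet K) {α : Type*} [MeasurableSpace α]
    {u : α → U} {y : α → Obs n Q} {σ : α → Measure (HybridState X Q)} (hu : Measurable u)
    (hy : Measurable y) (hσ : Measurable σ) :
    Measurable fun a => H.T K (u a) (y a) (finiteMeasureKernel _ (σ a)) := by
  refine measurable_of_measurable_lintegral fun g hg => ?_
  simp_rw [H.lintegral_T K hK _ _ _ hg]
  refine measurable_lintegral_kernel_comp (finiteMeasureKernel (HybridState X Q)) hσ ?_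
  refine ((measurable_const.indicator hK).comp measurable_snd).mul ?_
  refine measurable_lintegral_kernel_comp H.τ
    (g := fun p : α × HybridState X Q => (p.2, u p.1)) (by fun_prop) ?_
  exact (H.measurable_likelihood measurable_snd (hu.comp measurable_fst.fst)
    (hy.comp measurable_fst.fst)).mul (hg.comp measurable_snd)

omit [OpensMeasurableSpace U] in
lemma expectedNext_eq_lintegral_refObs [Nonempty Q] {V : Measure (HybridState X Q) → ℝ≥0∞}
    {σ : Measure (HybridState X Q)} {u : U} (hV : Measurable fun y => V (H.T K u y σ)) :
    H.expectedNext K V σ u = ∫⁻ y, V (H.T K u y σ) ∂H.refObs :=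
  (H.lintegral_refObs hV).symm

variable {ρ} {N : ℕ} {Sig : ℕ → Set (Measure (HybridState X Q))} {μbar : InfoPolicy X Q U}

/-- Although it is a supremum over uncountably many controls, `V_k^*` is measurable on the
information states: there it is the value of the measurable policy that attains the supremum. -/
lemma exists_measurable_eq_optValue [Nonempty Q] (hK : MeasurableSet K)
    (hSig : H.IsInfoStateSpace ρ K N Sig) (hmeas : ∀ k, Measurable (μbar k))
    (hopt : H.IsDPOptimal K N Sig μbar) (k : ℕ) (hk : k ≤ N) :
    ∃ W : Measure (HybridState X Q) → ℝ≥0∞, Measurable W ∧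
      ∀ σ ∈ Sig k, H.optValue K N k σ = W σ := by
  induction hk using Nat.decreasingInduction with
  | self => exact ⟨fun σ => σ K, Measure.measurable_coe hK, fun σ _ => H.optValue_self σ⟩
  | of_succ k hk ih =>
    obtain ⟨W, hW, hWeq⟩ := ih
    have hT : Measurable fun p : Measure (HybridState X Q) × Obs n Q =>
        W (H.T K (μbar k p.1) p.2 (finiteMeasureKernel _ p.1)) :=
      hW.comp (H.measurable_T hK ((hmeas k).comp measurable_fst) measurable_snd measurable_fst)
    refine ⟨fun σ => ∫⁻ y, W (H.T K (μbar k σ) y (finiteMeasureKernel _ σ)) ∂H.refObs,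
      hT.lintegral_prod_right', fun σ hσ => ?_⟩
    have := hSig.finite k hk.le σ hσ
    have hTσ : Measurable fun y => W (H.T K (μbar k σ) y σ) := by
      have h : Measurable fun y : Obs n Q =>
          W (H.T K (μbar k σ) y (finiteMeasureKernel _ σ)) :=
        hW.comp (H.measurable_T hK measurable_const measurable_id measurable_const)
      rwa [finiteMeasureKernel_apply] at h
    rw [H.optValue_eq_expectedNext hopt hk hσ, H.expectedNext_congr hSig hk hWeq hσ,
      H.expectedNext_eq_lintegral_refObs hTσ]
    simp only [finiteMeasureKernel_apply]

/-- The information state stays in the spaces `Σ_k` under every admissible policy. The absolute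
continuity needed to discard the exceptional null sets holds because `refObs` has a density. -/
lemma ae_eta_mem [Nonempty Q] [IsProbabilityMeasure ρ] (hK : MeasurableSet K)
    (hSig : H.IsInfoStateSpace ρ K N Sig) (hπ : π ∈ admissible n Q U) {k : ℕ} (hk : k ≤ N) :
    ∀ᵐ i ∂H.refInfo π k, H.eta ρ K k i ∈ Sig k := by
  induction k with
  | zero =>
    refine Filter.Eventually.of_forall fun i => ?_
    rw [H.eta_zero ρ K hK i]
    exact hSig.initial
  | succ k ih =>
    have hA : MeasurableSet {i : Info n Q U (k + 1) | H.eta ρ K (k + 1) i ∈ Sig (k + 1)}ᶜ :=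
      (H.measurable_eta ρ K hK (k + 1) (hSig.measurableSet _ hk)).compl
    have hA1 := (measurable_one (α := ℝ≥0∞)).indicator hA
    rw [ae_iff]
    change H.refInfo π (k + 1) ({i | H.eta ρ K (k + 1) i ∈ Sig (k + 1)}ᶜ) = 0
    rw [← lintegral_indicator_one hA, H.lintegral_refInfo_succ hπ k hA1]
    refine lintegral_eq_zero_of_ae_eq_zero ?_
    filter_upwards [ih (by omega)] with i hi
    have hext : Measurable fun y : Obs n Q => extendInfo i y (π k i) :=
      measurable_extendInfo measurable_const measurable_id measurable_const
    refine (H.lintegral_refObs (hA1.comp hext)).trans ?_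
    refine Finset.sum_eq_zero fun j _ => lintegral_eq_zero_of_ae_eq_zero ?_
    filter_upwards [hSig.step k (by omega) _ hi (π k i) j] with v hv
    have : H.eta ρ K (k + 1) (extendInfo i (v, j) (π k i)) ∈ Sig (k + 1) := by
      rwa [H.eta_extend ρ K hK]
    simp [this]

/-- One step of the dynamic programming recursion along an arbitrary admissible policy. -/
lemma lintegral_optValue_succ [Nonempty Q] [IsProbabilityMeasure ρ] (hK : MeasurableSet K)
    (hSig : H.IsInfoStateSpace ρ K N Sig) (hmeas : ∀ k, Measurable (μbar k))
    (hopt : H.IsDPOptimal K N Sig μbar) (hπ : π ∈ admissible n Q U) {k : ℕ} (hk : k < N) :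
    ∫⁻ i, H.optValue K N (k + 1) (H.eta ρ K (k + 1) i) ∂H.refInfo π (k + 1) =
      ∫⁻ i, H.expectedNext K (H.optValue K N (k + 1)) (H.eta ρ K k i) (π k i)
        ∂H.refInfo π k := by
  obtain ⟨W, hW, hWeq⟩ := H.exists_measurable_eq_optValue hK hSig hmeas hopt (k + 1) hk
  have hWη : Measurable fun i : Info n Q U (k + 1) => W (H.eta ρ K (k + 1) i) :=
    hW.comp (H.measurable_eta ρ K hK (k + 1))
  calc ∫⁻ i, H.optValue K N (k + 1) (H.eta ρ K (k + 1) i) ∂H.refInfo π (k + 1)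
      = ∫⁻ i, W (H.eta ρ K (k + 1) i) ∂H.refInfo π (k + 1) := by
        refine lintegral_congr_ae ?_
        filter_upwards [H.ae_eta_mem hK hSig hπ hk] with i hi using hWeq _ hi
    _ = ∫⁻ i, ∫⁻ y, W (H.T K (π k i) y (H.eta ρ K k i)) ∂H.refObs ∂H.refInfo π k := by
        rw [H.lintegral_refInfo_succ hπ k hWη]
        simp only [H.eta_extend ρ K hK]
    _ = _ := by
        refine lintegral_congr_ae ?_
        filter_upwards [H.ae_eta_mem hK hSig hπ hk.le] with i hi
        have hy : Measurable fun y => W (H.T K (π k i) y (H.eta ρ K k i)) := by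
          simp only [← H.eta_extend ρ K hK]
          exact hWη.comp
            (measurable_extendInfo measurable_const measurable_id measurable_const)
        rw [H.expectedNext_congr hSig hk hWeq hi, H.expectedNext_eq_lintegral_refObs hy]

lemma lintegral_eta_zero [Nonempty Q] (hK : MeasurableSet K) (hπ : π ∈ admissible n Q U)
    (V : Measure (HybridState X Q) → ℝ≥0∞) [IsProbabilityMeasure ρ] :
    ∫⁻ i, V (H.eta ρ K 0 i) ∂H.refInfo π 0 = V ρ := by
  have := H.isProbabilityMeasure_refInfo hπ 0
  simp [H.eta_zero ρ K hK]

/-- The expected value along any admissible policy never exceeds `V_0^*(ρ)`. -/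
theorem lintegral_optValue_le [Nonempty Q] [IsProbabilityMeasure ρ] (hK : MeasurableSet K)
    (hSig : H.IsInfoStateSpace ρ K N Sig) (hmeas : ∀ k, Measurable (μbar k))
    (hopt : H.IsDPOptimal K N Sig μbar) (hπ : π ∈ admissible n Q U) {k : ℕ} (hk : k ≤ N) :
    ∫⁻ i, H.optValue K N k (H.eta ρ K k i) ∂H.refInfo π k ≤ H.optValue K N 0 ρ := by
  induction k with
  | zero => exact (H.lintegral_eta_zero hK hπ _).le
  | succ k ih =>
    rw [H.lintegral_optValue_succ hK hSig hmeas hopt hπ hk]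
    refine (lintegral_mono fun i => ?_).trans (ih (by omega))
    rw [H.optValue_eq_iSup hk]
    exact le_iSup (fun u => H.expectedNext K (H.optValue K N (k + 1)) (H.eta ρ K k i) u) _

lemma induced_mem_admissible [IsProbabilityMeasure ρ] (hK : MeasurableSet K)
    (hmeas : ∀ k, Measurable (μbar k)) : H.induced ρ K μbar ∈ admissible n Q U :=
  fun k => (hmeas k).comp (H.measurable_eta ρ K hK k)

/-- Along the induced policy the expected value is constant in time: its control attains the
supremum at almost every information state. -/
theorem lintegral_optValue_induced [Nonempty Q] [IsProbabilityMeasure ρ] (hK : MeasurableSet K)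
    (hSig : H.IsInfoStateSpace ρ K N Sig) (hmeas : ∀ k, Measurable (μbar k))
    (hopt : H.IsDPOptimal K N Sig μbar) {k : ℕ} (hk : k ≤ N) :
    ∫⁻ i, H.optValue K N k (H.eta ρ K k i) ∂H.refInfo (H.induced ρ K μbar) k =
      H.optValue K N 0 ρ := by
  have hπ := H.induced_mem_admissible (ρ := ρ) hK hmeas
  induction k with
  | zero => exact H.lintegral_eta_zero hK hπ _
  | succ k ih =>
    rw [H.lintegral_optValue_succ hK hSig hmeas hopt hπ hk, ← ih (by omega)]
    refine lintegral_congr_ae ?_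
    filter_upwards [H.ae_eta_mem hK hSig hπ (show k ≤ N by omega)] with i hi
    exact (H.optValue_eq_expectedNext hopt hk hi).symm

end DynamicProgramming

end PODTSHS

end

theorem theorem2 {n : ℕ} {X : Set (Rn n)} {Q : Type*} [Fintype Q] [MeasurableSpace Q]
    [MeasurableSingletonClass Q]
    {U : Type*} [TopologicalSpace U] [TopologicalSpace.MetrizableSpace U] [CompactSpace U]
    [MeasurableSpace U] [BorelSpace U]
    (H : PODTSHS X Q U) (ρ : Measure (HybridState X Q)) [IsProbabilityMeasure ρ]
    (K : Set (HybridState X Q)) (hK : MeasurableSet K) (N : ℕ)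
    (Sig : ℕ → Set (Measure (HybridState X Q))) (hSig : H.IsInfoStateSpace ρ K N Sig)
    (μbar : PODTSHS.InfoPolicy X Q U) (hmeas : ∀ k, Measurable (μbar k))
    (hopt : H.IsDPOptimal K N Sig μbar) :
    (∀ π ∈ PODTSHS.admissible n Q U, ∀ k ≤ N, H.EtaIsCondExp ρ K π k) ∧
    H.induced ρ K μbar ∈ PODTSHS.admissible n Q U ∧
    H.infoReward ρ K N μbar = (⨆ π ∈ PODTSHS.admissible n Q U, H.safetyProb ρ K N π) ∧
    (⨆ π ∈ PODTSHS.admissible n Q U, H.safetyProb ρ K N π) =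
      H.safetyProb ρ K N (H.induced ρ K μbar) := by
  have : Nonempty Q := (nonempty_of_isProbabilityMeasure ρ).map Prod.snd
  have hadm := H.induced_mem_admissible (ρ := ρ) hK hmeas
  have hle : ∀ π ∈ PODTSHS.admissible n Q U, H.safetyProb ρ K N π ≤ H.optValue K N 0 ρ := by
    intro π hπ
    have h := H.lintegral_optValue_le hK hSig hmeas hopt hπ le_rfl
    simp only [PODTSHS.optValue_self] at h
    rwa [H.safetyProb_eq ρ hK hπ]
  have hind : ∫⁻ i, H.eta ρ K N i K ∂H.refInfo (H.induced ρ K μbar) N = H.optValue K N 0 ρ := by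
    have h := H.lintegral_optValue_induced hK hSig hmeas hopt le_rfl
    simpa only [PODTSHS.optValue_self] using h
  have hsafe : H.safetyProb ρ K N (H.induced ρ K μbar) = H.optValue K N 0 ρ := by
    rw [H.safetyProb_eq ρ hK hadm, hind]
  have hsup : (⨆ π ∈ PODTSHS.admissible n Q U, H.safetyProb ρ K N π) =
      H.safetyProb ρ K N (H.induced ρ K μbar) :=
    le_antisymm (iSup₂_le fun π hπ => (hle π hπ).trans_eq hsafe.symm)
      (le_iSup₂ (f := fun π _ => H.safetyProb ρ K N π) _ hadm)
  refine ⟨fun π hπ k _ => H.etaIsCondExp ρ hK hπ k, hadm, ?_, hsup⟩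
  rw [hsup, hsafe, H.infoReward_eq ρ hK N hadm, hind]
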